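/- Let $G$ be a finite abelian group, written additively, with $G\cong\mathbb{Z}_4\times H$ where $H$ is an abelian group of odd order, and let $a$ be the unique element of order two in $G$. Let $\mathcal{C}\subseteq G$ satisfy $\mathcal{C}=-\mathcal{C}$ and $0\notin\mathcal{C}$, and let $X=X(G,\mathcal{C})$ be the Cayley graph with vertex set $G$ in which $g$ and $h$ are adjacent if and only if $h-g\in\mathcal{C}$; let $A$ be its adjacency matrix. Suppose that $X$ admits perfect state transfer, that is, there are distinct vertices $u\neq v$, a time $\tau\in\mathbb{R}$ and a scalar $\lambda\in\mathbb{C}$ such that $e^{i\tau A}\mathbf{e}_v=\lambda\,\mathbf{e}_u$, where $\mathbf{e}_x$ denotes the standard basis vector indexed by $x$. If $a\in\mathcal{C}$, then all eigenvalues of $A$ are odd integers, and $-1$ is an eigenvalue of $A$ with multiplicity exactly $|G|/2$. If $a\notin\mathcal{C}$, then all eigenvalues of $A$ are even integers, and $0$ is an eigenvalue of $A$ with multiplicity exactly $|G|/2$. -/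

import Mathlib

namespace QuantumWalk

variable {V : Type*} [Fintype V] [DecidableEq V]

/-- The transition matrix `U(t) = exp(i t A)` at time `t` of the continuous-time quantum walk on the
graph `X` with adjacency matrix `A`. -/
noncomputable def transitionMatrix (X : SimpleGraph V) [DecidableRel X.Adj] (t : ℝ) :
    Matrix V V ℂ :=
  NormedSpace.exp ((Complex.I * (t : ℂ)) • X.adjMatrix ℂ)

/-- There is perfect state transfer on `X` from `u` to `v` at time `τ` with phase factor `l`:
`U(τ) e_v = l e_u`. -/
def IsPST (X : SimpleGraph V) [DecidableRel X.Adj] (u v : V) (τ : ℝ) (l : ℂ) : Prop :=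
  (transitionMatrix X τ).mulVec (Pi.single v 1) = l • (Pi.single u 1 : V → ℂ)

/-- The graph `X` admits perfect state transfer: it occurs between some two distinct vertices at
some time. -/
def AdmitsPST (X : SimpleGraph V) [DecidableRel X.Adj] : Prop :=
  ∃ u v : V, u ≠ v ∧ ∃ (τ : ℝ) (l : ℂ), IsPST X u v τ l

/-- The complex number `μ` is an eigenvalue of (the adjacency matrix of) the graph `X`. -/
def IsEigenvalue (X : SimpleGraph V) [DecidableRel X.Adj] (μ : ℂ) : Prop :=
  Module.End.HasEigenvalue (Matrix.toLin' (X.adjMatrix ℂ)) μ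

/-- The multiplicity of `μ` as an eigenvalue of the graph `X`: the dimension of the eigenspace.
(The adjacency matrix is symmetric, so this is also the algebraic multiplicity.) -/
noncomputable def eigenvalueMultiplicity (X : SimpleGraph V) [DecidableRel X.Adj] (μ : ℂ) : ℕ :=
  Module.finrank ℂ (Module.End.eigenspace (Matrix.toLin' (X.adjMatrix ℂ)) μ)

end QuantumWalk

/-! The characters `ψ` of `G` diagonalise `A`, with eigenvalues `θ_ψ = ∑_{c ∈ C} ψ c`. Comparing
state transfer on `ψ` and on the trivial character gives `exp(iτ(θ_ψ - |C|)) = ψ(u - v)`. As `C =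
-C`, this forces `u - v = a`, so `(τ/π)(θ_ψ - |C|)` is an integer, even or odd according to `ψ a =
±1`. Since `A` has trace zero, `τ/π` is rational, so the algebraic integers `θ_ψ` are integers, and
those with `ψ a = -1` share one parity.

The key step is `AddChar.mem_iff_sub_mem_of_even_sub`. Take `b` with `2b = a`. Fourier inversion
over the characters with `ψ b = i` (all have `ψ a = -1`) and the common parity make `N(x + iy)/2` an
algebraic integer, where `N = |G|/4` is odd and `x = 1_C(g) - 1_C(g - a)`. Its norm forces `x = 0`.
Hence `C` is invariant under `a` away from `0` and `a`, and every `ψ` with `ψ a = -1`, which is half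
of them, has `θ_ψ = -1_C(a)`. The other characters have `θ_ψ ≡ |C|` mod 2, and their phases differ
in parity, so they never attain this value. -/

open Matrix Module

/-! ### Diagonal operators and the matrix exponential. -/

/-- If `f` acts diagonally on a basis `b` with diagonal `d`, then the eigenspace of `μ` is spanned
by the basis vectors `b i` with `d i = μ`. -/
theorem Module.Basis.eigenspace_eq_span_image {ι K M : Type*} [Field K] [AddCommGroup M]
    [Module K M] (b : Basis ι K M) (f : Module.End K M) (d : ι → K)
    (hf : ∀ i, f (b i) = d i • b i) (μ : K) :
    Module.End.eigenspace f μ = Submodule.span K (b '' {i | d i = μ}) := by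
  ext x
  have hrepr (i : ι) : b.repr (f x) i = d i * b.repr x i := by
    have h : Finsupp.lapply i ∘ₗ b.repr.toLinearMap ∘ₗ f =
        d i • (Finsupp.lapply i ∘ₗ b.repr.toLinearMap) := by
      refine b.ext fun j => ?_
      by_cases hij : j = i
      · subst hij; simp [hf]
      · simp [hf, Finsupp.single_eq_of_ne (Ne.symm hij)]
    simpa using LinearMap.congr_fun h x
  rw [Module.End.mem_eigenspace_iff, b.mem_span_image]
  constructor
  · intro hx i hi
    have h := hrepr i
    rw [hx, map_smul, Finsupp.smul_apply, smul_eq_mul] at h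
    exact (mul_right_cancel₀ (Finsupp.mem_support_iff.1 hi) h).symm
  · intro hx
    refine b.repr.injective (Finsupp.ext fun i => ?_)
    rw [hrepr, map_smul, Finsupp.smul_apply, smul_eq_mul]
    by_cases hi : b.repr x i = 0
    · simp [hi]
    · rw [show d i = μ from hx (Finsupp.mem_support_iff.2 hi)]

theorem Module.Basis.finrank_eigenspace {ι K M : Type*} [Fintype ι] [Field K] [DecidableEq K]
    [AddCommGroup M] [Module K M] (b : Basis ι K M) (f : Module.End K M) (d : ι → K)
    (hf : ∀ i, f (b i) = d i • b i) (μ : K) :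
    finrank K (Module.End.eigenspace f μ) = Fintype.card {i // d i = μ} := by
  rw [b.eigenspace_eq_span_image f d hf μ, ← Subtype.range_coe_subtype, ← Set.range_comp]
  exact finrank_span_eq_card (b.linearIndependent.comp _ Subtype.val_injective)

theorem Matrix.exp_mulVec_of_mulVec_eq_smul {n : Type*} [Fintype n] [DecidableEq n]
    {M : Matrix n n ℂ} {x : n → ℂ} {μ : ℂ} (h : M *ᵥ x = μ • x) :
    NormedSpace.exp M *ᵥ x = Complex.exp μ • x := by
  let _ : NormedRing (Matrix n n ℂ) := Matrix.linftyOpNormedRing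
  let _ : NormedAlgebra ℂ (Matrix n n ℂ) := Matrix.linftyOpNormedAlgebra
  let _ : NormedAlgebra ℚ (Matrix n n ℂ) := NormedAlgebra.restrictScalars ℚ ℂ _
  have hpow (k : ℕ) : (M ^ k) *ᵥ x = μ ^ k • x := by
    induction k with
    | zero => simp
    | succ k ih => rw [pow_succ, ← mulVec_mulVec, h, mulVec_smul, ih, smul_smul, pow_succ']
  -- Evaluation at `x` is linear and continuous, so it passes through the exponential series term by
  -- term.
  let T : Matrix n n ℂ →ₗ[ℂ] (n → ℂ) := (Matrix.mulVecBilin ℂ ℂ).flip x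
  have hT : Continuous T := T.continuous_of_finiteDimensional
  have h1 := (NormedSpace.exp_series_hasSum_exp' (𝕂 := ℂ) M).map T hT
  have h2 := (NormedSpace.exp_series_hasSum_exp' (𝕂 := ℂ) μ).smul_const x
  rw [Complex.exp_eq_exp_ℂ]
  refine h1.unique (h2.congr_fun fun k => ?_)
  change T _ = _
  rw [map_smul, smul_assoc]
  congr 1
  exact hpow k

/-! ### Characters as eigenvectors of the Cayley graph. -/

/-- The sum of the character `ψ` over `C`, that is, the eigenvalue of the Cayley graph `X(G, C)`
belonging to `ψ`. -/
noncomputable def AddChar.sumOver {G : Type*} [AddCommGroup G] [Fintype G] (C : Set G)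
    (ψ : AddChar G ℂ) : ℂ :=
  ∑ c : G, C.indicator ψ c

theorem SimpleGraph.addCayley_adj_iff_sub_mem {G : Type*} [AddCommGroup G] {C : Set G}
    (hneg : ∀ g ∈ C, -g ∈ C) (h0 : (0 : G) ∉ C) (g h : G) :
    (SimpleGraph.addCayley C).Adj g h ↔ h - g ∈ C := by
  rw [SimpleGraph.addCayley_adj']
  constructor
  · rintro ⟨-, c, hc, rfl | rfl⟩
    · simpa using hc
    · simpa using hneg c hc
  · intro hc
    refine ⟨?_, h - g, hc, Or.inl (by abel)⟩
    rintro rfl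
    simp [h0] at hc

theorem SimpleGraph.addCayley_adjMatrix_mulVec {G : Type*} [AddCommGroup G] [Fintype G]
    {C : Set G} [DecidableRel (SimpleGraph.addCayley C).Adj]
    (hneg : ∀ g ∈ C, -g ∈ C) (h0 : (0 : G) ∉ C) (ψ : AddChar G ℂ) :
    (SimpleGraph.addCayley C).adjMatrix ℂ *ᵥ ψ = ψ.sumOver C • (ψ : G → ℂ) := by
  classical
  funext g
  rw [Pi.smul_apply, smul_eq_mul, AddChar.sumOver, Finset.sum_mul, mulVec, dotProduct,
    ← Equiv.sum_comp (Equiv.addRight g) (fun x =>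
      (SimpleGraph.addCayley C).adjMatrix ℂ g x * ψ x)]
  refine Finset.sum_congr rfl fun c _ => ?_
  simp [SimpleGraph.adjMatrix_apply, SimpleGraph.addCayley_adj_iff_sub_mem hneg h0,
    Set.indicator_apply, AddChar.map_add_eq_mul]

namespace QuantumWalk

variable {G : Type*} [AddCommGroup G] [Fintype G] [DecidableEq G] {C : Set G}
  [DecidableRel (SimpleGraph.addCayley C).Adj]

theorem toLin'_complexBasis (hneg : ∀ g ∈ C, -g ∈ C) (h0 : (0 : G) ∉ C) (ψ : AddChar G ℂ) :
    Matrix.toLin' ((SimpleGraph.addCayley C).adjMatrix ℂ) (AddChar.complexBasis G ψ) =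
      ψ.sumOver C • AddChar.complexBasis G ψ := by
  rw [AddChar.complexBasis_apply, Matrix.toLin'_apply,
    SimpleGraph.addCayley_adjMatrix_mulVec hneg h0]

theorem eigenvalueMultiplicity_addCayley (hneg : ∀ g ∈ C, -g ∈ C) (h0 : (0 : G) ∉ C) (μ : ℂ) :
    eigenvalueMultiplicity (SimpleGraph.addCayley C) μ =
      Fintype.card {ψ : AddChar G ℂ // ψ.sumOver C = μ} :=
  (AddChar.complexBasis G).finrank_eigenspace _ _ (toLin'_complexBasis hneg h0) μ

theorem isEigenvalue_addCayley_iff (hneg : ∀ g ∈ C, -g ∈ C) (h0 : (0 : G) ∉ C) (μ : ℂ) :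
    IsEigenvalue (SimpleGraph.addCayley C) μ ↔ ∃ ψ : AddChar G ℂ, ψ.sumOver C = μ := by
  rw [IsEigenvalue, Module.End.hasEigenvalue_iff, ne_eq, ← Submodule.finrank_eq_zero (R := ℂ),
    ← ne_eq, ← Nat.pos_iff_ne_zero,
    (AddChar.complexBasis G).finrank_eigenspace _ _ (toLin'_complexBasis hneg h0) μ,
    Fintype.card_pos_iff, nonempty_subtype]

/-- Pair `U(τ) e_v = l e_u` with `ψ` and move the symmetric matrix `U(τ)` onto its eigenvector `ψ`.
-/
theorem IsPST.exp_mul_eq (hneg : ∀ g ∈ C, -g ∈ C) (h0 : (0 : G) ∉ C) {u v : G} {τ : ℝ} {l : ℂ}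
    (h : IsPST (SimpleGraph.addCayley C) u v τ l) (ψ : AddChar G ℂ) :
    Complex.exp (Complex.I * τ * ψ.sumOver C) * ψ v = l * ψ u := by
  have hsymm : (transitionMatrix (SimpleGraph.addCayley C) τ)ᵀ =
      transitionMatrix (SimpleGraph.addCayley C) τ := by
    rw [transitionMatrix, ← Matrix.exp_transpose, transpose_smul, SimpleGraph.transpose_adjMatrix]
  have hψ : transitionMatrix (SimpleGraph.addCayley C) τ *ᵥ ψ =
      Complex.exp (Complex.I * τ * ψ.sumOver C) • (ψ : G → ℂ) := by
    refine Matrix.exp_mulVec_of_mulVec_eq_smul ?_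
    rw [smul_mulVec, SimpleGraph.addCayley_adjMatrix_mulVec hneg h0, smul_smul]
  have h1 := congrArg (fun x => (ψ : G → ℂ) ⬝ᵥ x) h
  simp only [dotProduct_mulVec, dotProduct_smul] at h1
  rw [← mulVec_transpose, hsymm, hψ] at h1
  simpa using h1

end QuantumWalk

/-! ### Integrality and orthogonality of character sums. -/

namespace AddChar

variable {G : Type*} [AddCommGroup G] [Fintype G]

theorem isIntegral_apply (ψ : AddChar G ℂ) (g : G) : IsIntegral ℤ (ψ g) := by
  refine IsIntegral.of_pow (n := Fintype.card G) Fintype.card_pos ?_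
  rw [← AddChar.map_nsmul_eq_pow, card_nsmul_eq_zero, AddChar.map_zero_eq_one]
  exact isIntegral_one

theorem isIntegral_sumOver (C : Set G) (ψ : AddChar G ℂ) : IsIntegral ℤ (ψ.sumOver C) := by
  classical
  refine IsIntegral.sum _ fun c _ => ?_
  rw [Set.indicator_apply]
  split_ifs
  exacts [ψ.isIntegral_apply c, isIntegral_zero]

/-- This is the vanishing of the trace of `A`: the graph has no loops. -/
theorem sum_sumOver {C : Set G} (h0 : (0 : G) ∉ C) : ∑ ψ : AddChar G ℂ, ψ.sumOver C = 0 := by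
  classical
  unfold sumOver
  rw [Finset.sum_comm]
  refine Finset.sum_eq_zero fun c _ => ?_
  by_cases hc : c ∈ C
  · simp only [Set.indicator_of_mem hc]
    exact AddChar.sum_apply_eq_zero_iff_ne_zero.2 (by rintro rfl; exact h0 hc)
  · simp [Set.indicator_of_notMem hc]

theorem zero_sumOver (C : Set G) : (0 : AddChar G ℂ).sumOver C = (C.ncard : ℂ) := by
  classical
  rw [sumOver, Set.ncard_eq_toFinset_card' C]
  simp [Set.indicator_apply, Set.toFinset]

theorem neg_sumOver {C : Set G} (hneg : ∀ g ∈ C, -g ∈ C) (ψ : AddChar G ℂ) :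
    (-ψ).sumOver C = ψ.sumOver C := by
  classical
  have hiff (g : G) : -g ∈ C ↔ g ∈ C := ⟨fun h => by simpa using hneg _ h, hneg g⟩
  unfold sumOver
  rw [← Equiv.sum_comp (Equiv.neg G)]
  refine Finset.sum_congr rfl fun c _ => ?_
  simp [Set.indicator_apply, hiff, AddChar.neg_apply]

omit [Fintype G] in
theorem apply_eq_one_or_neg_one {a : G} (ha : 2 • a = 0) (ψ : AddChar G ℂ) :
    ψ a = 1 ∨ ψ a = -1 := by
  rw [← sq_eq_one_iff, ← AddChar.map_nsmul_eq_pow, ha, AddChar.map_zero_eq_one]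

theorem two_mul_card_apply_eq_neg_one {a : G} (ha : 2 • a = 0) (ha0 : a ≠ 0) :
    2 * Fintype.card {ψ : AddChar G ℂ // ψ a = -1} = Fintype.card G := by
  classical
  have h := AddChar.sum_apply_eq_zero_iff_ne_zero.2 ha0
  have h1 : ∑ ψ : AddChar G ℂ, (1 - ψ a) = Fintype.card G := by
    rw [Finset.sum_sub_distrib, h]; simp
  -- Since `ψ a = ±1`, the term `1 - ψ a` is twice the indicator of `ψ a = -1`.
  have h2 : ∑ ψ : AddChar G ℂ, (1 - ψ a) = ∑ ψ : AddChar G ℂ, if ψ a = -1 then 2 else 0 := by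
    refine Finset.sum_congr rfl fun ψ _ => ?_
    rcases ψ.apply_eq_one_or_neg_one ha with h | h <;> norm_num [h]
  rw [h2, ← Finset.sum_filter, Finset.sum_const, ← Fintype.card_subtype, nsmul_eq_mul,
    mul_comm] at h1
  exact_mod_cast h1

theorem exists_apply_eq_neg_one {a : G} (ha : 2 • a = 0) (ha0 : a ≠ 0) :
    ∃ ψ : AddChar G ℂ, ψ a = -1 := by
  obtain ⟨ψ, hψ⟩ := AddChar.exists_apply_ne_zero.2 ha0
  exact ⟨ψ, (ψ.apply_eq_one_or_neg_one ha).resolve_left hψ⟩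

end AddChar

/-- A complex number that is rational and integral over `ℤ` is an integer. -/
theorem IsIntegral.exists_int_eq_of_rat {z : ℂ} (hz : IsIntegral ℤ z) {q : ℚ} (hq : z = q) :
    ∃ m : ℤ, z = m := by
  subst hq
  have h : IsIntegral ℤ q := by
    rw [← eq_ratCast (algebraMap ℚ ℂ) q] at hz
    exact (isIntegral_algebraMap_iff (algebraMap ℚ ℂ).injective).1 hz
  obtain ⟨m, hm⟩ := IsIntegrallyClosed.isIntegral_iff.1 h
  exact ⟨m, by rw [← hm]; simp⟩

/-! ### Arithmetic of the eigenvalues under perfect state transfer. -/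

namespace QuantumWalk

variable {G : Type*} [AddCommGroup G] [Fintype G] [DecidableEq G] {C : Set G}
  [DecidableRel (SimpleGraph.addCayley C).Adj]

/-- Dividing by the relation for the trivial character, whose eigenvalue is `|C|`, eliminates the
phase `l`. -/
theorem IsPST.exp_mul_sub_eq (hneg : ∀ g ∈ C, -g ∈ C) (h0 : (0 : G) ∉ C) {u v : G} {τ : ℝ} {l : ℂ}
    (h : IsPST (SimpleGraph.addCayley C) u v τ l) (ψ : AddChar G ℂ) :
    Complex.exp (Complex.I * τ * (ψ.sumOver C - (C.ncard : ℂ))) = ψ (u - v) := by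
  have h1 := h.exp_mul_eq hneg h0 ψ
  have h2 := h.exp_mul_eq hneg h0 0
  rw [AddChar.zero_sumOver, AddChar.zero_apply, AddChar.zero_apply, mul_one, mul_one] at h2
  rw [mul_sub, Complex.exp_sub, div_eq_iff (Complex.exp_ne_zero _), h2, sub_eq_add_neg,
    AddChar.map_add_eq_mul, AddChar.map_neg_eq_inv]
  have hv := (ψ.val_isUnit v).ne_zero
  field_simp
  linear_combination h1

/-- `ψ` and `-ψ` have the same eigenvalue, so `ψ (u - v)` equals its own inverse for every `ψ`. -/
theorem IsPST.two_nsmul_sub_eq_zero (hneg : ∀ g ∈ C, -g ∈ C) (h0 : (0 : G) ∉ C) {u v : G} {τ : ℝ}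
    {l : ℂ} (h : IsPST (SimpleGraph.addCayley C) u v τ l) : 2 • (u - v) = 0 := by
  rw [← AddChar.forall_apply_eq_zero]
  intro ψ
  have h1 := h.exp_mul_sub_eq hneg h0 ψ
  rw [← AddChar.neg_sumOver hneg, h.exp_mul_sub_eq hneg h0, AddChar.neg_apply,
    AddChar.map_neg_eq_inv] at h1
  rw [two_nsmul, AddChar.map_add_eq_mul]
  nth_rw 1 [← h1]
  exact inv_mul_cancel₀ (ψ.val_isUnit _).ne_zero

/-- Under perfect state transfer along `a`, all eigenvalue differences are commensurable, and the
parity of the quotient is read off from the values of the characters at `a`. -/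
theorem IsPST.exists_phase (hneg : ∀ g ∈ C, -g ∈ C) (h0 : (0 : G) ∉ C) {u v : G} {τ : ℝ} {l : ℂ}
    (h : IsPST (SimpleGraph.addCayley C) u v τ l) :
    ∃ k : AddChar G ℂ → ℤ, ∀ ψ, (τ / Real.pi : ℂ) * (ψ.sumOver C - (C.ncard : ℂ)) = k ψ ∧
      (ψ (u - v) = 1 ∧ Even (k ψ) ∨ ψ (u - v) = -1 ∧ Odd (k ψ)) := by
  have hpi : (Real.pi : ℂ) ≠ 0 := Complex.ofReal_ne_zero.2 Real.pi_ne_zero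
  suffices H : ∀ ψ : AddChar G ℂ, ∃ k : ℤ,
      (τ / Real.pi : ℂ) * (ψ.sumOver C - (C.ncard : ℂ)) = k ∧
      (ψ (u - v) = 1 ∧ Even k ∨ ψ (u - v) = -1 ∧ Odd k) from Classical.skolem.1 H
  intro ψ
  have h1 := h.exp_mul_sub_eq hneg h0 ψ
  rcases ψ.apply_eq_one_or_neg_one (h.two_nsmul_sub_eq_zero hneg h0) with hψ | hψ
  · obtain ⟨n, hn⟩ := Complex.exp_eq_one_iff.1 (h1.trans hψ)
    refine ⟨2 * n, ?_, Or.inl ⟨hψ, even_two_mul n⟩⟩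
    rw [div_mul_eq_mul_div, div_eq_iff hpi]
    apply mul_left_cancel₀ Complex.I_ne_zero
    push_cast
    linear_combination hn
  · have h2 : Complex.exp (Complex.I * τ * (ψ.sumOver C - (C.ncard : ℂ)) + Real.pi * Complex.I)
        = 1 := by rw [Complex.exp_add, h1, hψ, Complex.exp_pi_mul_I]; norm_num
    obtain ⟨n, hn⟩ := Complex.exp_eq_one_iff.1 h2
    refine ⟨2 * n - 1, ?_, Or.inr ⟨hψ, ⟨n - 1, by ring⟩⟩⟩
    rw [div_mul_eq_mul_div, div_eq_iff hpi]
    apply mul_left_cancel₀ Complex.I_ne_zero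
    push_cast
    linear_combination hn

/-- An abelian Cayley graph with perfect state transfer is integral. -/
theorem IsPST.exists_int_sumOver (hneg : ∀ g ∈ C, -g ∈ C) (h0 : (0 : G) ∉ C) {u v : G}
    (huv : u ≠ v) {τ : ℝ} {l : ℂ} (h : IsPST (SimpleGraph.addCayley C) u v τ l)
    (ψ : AddChar G ℂ) : ∃ m : ℤ, ψ.sumOver C = m := by
  obtain ⟨k, hk⟩ := h.exists_phase hneg h0
  -- An odd `k φ` is nonzero, which rules out `τ = 0` and empty `C`.
  obtain ⟨φ, hφ⟩ := AddChar.exists_apply_eq_neg_one (h.two_nsmul_sub_eq_zero hneg h0)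
    (sub_ne_zero.2 huv)
  have hkφ : Odd (k φ) := ((hk φ).2.resolve_left (by rw [hφ]; norm_num)).2
  have hr : (τ / Real.pi : ℂ) * (φ.sumOver C - (C.ncard : ℂ)) ≠ 0 := by
    rw [(hk φ).1, Int.cast_ne_zero]
    rintro h; simp [h] at hkφ
  have hr0 := left_ne_zero_of_mul hr
  have hC : (C.ncard : ℂ) ≠ 0 := by
    intro hC
    rw [Nat.cast_eq_zero, Set.ncard_eq_zero] at hC
    subst hC
    simp [AddChar.sumOver] at hr
  -- Summing the phase relation over all characters kills the eigenvalues by the trace identity,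
  -- leaving `τ/π` rational.
  have hsum : (τ / Real.pi : ℂ) * (Fintype.card G * C.ncard) = ((-∑ ψ, k ψ : ℤ) : ℂ) := by
    push_cast
    simp only [← (hk _).1]
    rw [← Finset.mul_sum, Finset.sum_sub_distrib, AddChar.sum_sumOver h0]
    simp
  have hcard : (Fintype.card G : ℂ) ≠ 0 := Nat.cast_ne_zero.2 Fintype.card_ne_zero
  have hrq : (τ / Real.pi : ℂ) = (((-∑ ψ, k ψ : ℤ) : ℚ) / (Fintype.card G * C.ncard) : ℚ) := by
    push_cast at hsum ⊢
    rw [eq_div_iff (mul_ne_zero hcard hC), hsum]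
  refine (ψ.isIntegral_sumOver C).exists_int_eq_of_rat
    (q := C.ncard + k ψ / (((-∑ ψ, k ψ : ℤ) : ℚ) / (Fintype.card G * C.ncard))) ?_
  have h1 := (hk ψ).1
  rw [Rat.cast_add, Rat.cast_div, ← hrq, Rat.cast_natCast, Rat.cast_intCast, ← h1,
    mul_div_cancel_left₀ _ hr0]
  ring

/-- Integral eigenvalues `m ψ` together with integers `k ψ` witnessing that the eigenvalue
differences `m ψ - |C|` are proportional to `k ψ`. -/
theorem IsPST.exists_int_eigenvalues (hneg : ∀ g ∈ C, -g ∈ C) (h0 : (0 : G) ∉ C) {u v : G}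
    (huv : u ≠ v) {τ : ℝ} {l : ℂ} (h : IsPST (SimpleGraph.addCayley C) u v τ l) :
    ∃ m k : AddChar G ℂ → ℤ, (∀ ψ, ψ.sumOver C = m ψ) ∧
      (∀ ψ, ψ (u - v) = 1 ∧ Even (k ψ) ∨ ψ (u - v) = -1 ∧ Odd (k ψ)) ∧
      (∀ ψ φ, (m ψ - C.ncard) * k φ = (m φ - C.ncard) * k ψ) ∧
      (∀ ψ φ, m ψ = m φ → k ψ = k φ) := by
  obtain ⟨k, hk⟩ := h.exists_phase hneg h0
  choose m hm using h.exists_int_sumOver hneg h0 huv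
  simp only [hm] at hk
  refine ⟨m, k, hm, fun ψ => (hk ψ).2, fun ψ φ => ?_, fun ψ φ hmk => ?_⟩
  · have : ((m ψ : ℂ) - C.ncard) * k φ = (m φ - C.ncard) * k ψ := by
      rw [← (hk φ).1, ← (hk ψ).1]; ring
    exact_mod_cast this
  · have := (hk ψ).1
    rw [hmk, (hk φ).1] at this
    exact_mod_cast this.symm

end QuantumWalk

/-! ### Fourier inversion on `ψ b = i` and translation invariance of `C`. -/

/-- The indicator of `z = I` on the fourth roots of unity as a combination of powers. -/
theorem Complex.four_mul_ite_eq_I {z : ℂ} (hz : z ^ 4 = 1) :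
    4 * (if z = Complex.I then 1 else 0) =
      1 - Complex.I * z - z ^ 2 + Complex.I * z ^ 3 := by
  have h : (z - 1) * (z + 1) * (z - Complex.I) * (z + Complex.I) = 0 := by
    linear_combination hz - (z ^ 2 - 1) * Complex.I_sq
  have hI := Complex.I_sq
  have h1 : (1 : ℂ) ≠ Complex.I := by simp [Complex.ext_iff]
  have h2 : (-1 : ℂ) ≠ Complex.I := by simp [Complex.ext_iff]
  have h3 : -Complex.I ≠ Complex.I := by
    intro h; have := congrArg Complex.im h; norm_num at this
  rcases mul_eq_zero.1 h with h | h
  · rcases mul_eq_zero.1 h with h | h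
    · rcases mul_eq_zero.1 h with h | h
      · rw [sub_eq_zero.1 h, if_neg h1]; ring
      · rw [eq_neg_of_add_eq_zero_left h, if_neg h2]; ring
    · rw [sub_eq_zero.1 h, if_pos rfl]
      linear_combination (3 - Complex.I ^ 2) * hI
  · rw [eq_neg_of_add_eq_zero_left h, if_neg h3]
    linear_combination (Complex.I ^ 2 - 1) * hI

namespace AddChar

variable {G : Type*} [AddCommGroup G] [Fintype G]

/-- Fourier inversion over the characters with `ψ b = I`, for `b` of exponent four. -/
theorem four_mul_sum_sumOver_mul_apply_neg [DecidableEq G] (C : Set G) {b : G} (hb : 4 • b = 0)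
    (g : G) :
    4 * ∑ ψ : AddChar G ℂ, (if ψ b = Complex.I then ψ.sumOver C * ψ (-g) else 0) =
      Fintype.card G * (C.indicator 1 g - Complex.I * C.indicator 1 (g - b) -
        C.indicator 1 (g - 2 • b) + Complex.I * C.indicator 1 (g - 3 • b)) := by
  classical
  have key (x : G) : ∑ ψ : AddChar G ℂ, ψ.sumOver C * ψ (x - g) =
      Fintype.card G * C.indicator 1 (g - x) := by
    have h1 (ψ : AddChar G ℂ) : ψ.sumOver C * ψ (x - g) =
        ∑ c, C.indicator 1 c * ψ (c + (x - g)) := by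
      rw [sumOver, Finset.sum_mul]
      refine Finset.sum_congr rfl fun c _ => ?_
      simp [Set.indicator_apply, AddChar.map_add_eq_mul]
    simp_rw [h1]
    rw [Finset.sum_comm]
    simp_rw [← Finset.mul_sum, AddChar.sum_apply_eq_ite]
    rw [Finset.sum_eq_single (g - x)]
    · simp [mul_comm]
    · intro c _ hc
      rw [if_neg, mul_zero]
      intro h
      exact hc (by rw [eq_neg_of_add_eq_zero_left h]; abel)
    · simp
  -- Expanding the indicator of `ψ b = i` in powers of `ψ b` turns each power into a translate by a
  -- multiple of `b`.
  have h2 (ψ : AddChar G ℂ) :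
      4 * (if ψ b = Complex.I then ψ.sumOver C * ψ (-g) else 0) =
        ψ.sumOver C * ψ (0 - g) - Complex.I * (ψ.sumOver C * ψ (b - g)) -
          ψ.sumOver C * ψ (2 • b - g) + Complex.I * (ψ.sumOver C * ψ (3 • b - g)) := by
    have h4 : ψ b ^ 4 = 1 := by
      rw [← AddChar.map_nsmul_eq_pow, hb, AddChar.map_zero_eq_one]
    have := Complex.four_mul_ite_eq_I h4
    simp only [sub_eq_add_neg, AddChar.map_add_eq_mul, AddChar.map_nsmul_eq_pow,
      AddChar.map_zero_eq_one]
    rw [← mul_boole, mul_left_comm, this]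
    ring
  rw [Finset.mul_sum]
  simp_rw [h2]
  rw [Finset.sum_add_distrib, Finset.sum_sub_distrib, Finset.sum_sub_distrib, ← Finset.mul_sum,
    ← Finset.mul_sum, key, key, key, key]
  simp only [sub_zero]
  ring

/-- If the eigenvalues belonging to the characters with `ψ b = I` are integers of the same parity,
where `4 • b = 0` and `|G|` is four times an odd number, then `C` is invariant under translation by `2 • b`
outside of the subgroup generated by `b`. -/
theorem mem_iff_sub_mem_of_even_sub (C : Set G) {b : G} (hb : 4 • b = 0)
    {N : ℕ} (hN : Odd N) (hcard : Fintype.card G = 4 * N) (m : AddChar G ℂ → ℤ)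
    (hm : ∀ ψ : AddChar G ℂ, ψ.sumOver C = m ψ) (ε : ℤ)
    (hε : ∀ ψ : AddChar G ℂ, ψ b = Complex.I → Even (m ψ - ε)) {g : G}
    (hg : ∀ j < 4, g ≠ j • b) : g ∈ C ↔ g - 2 • b ∈ C := by
  classical
  -- For the set `{0}` all character sums are `1`, so inversion gives `∑ ψ(-g) = 0` over `ψ b = i`
  -- when `g` is not a multiple of `b`. This removes the common residue `ε`.
  have hconst := four_mul_sum_sumOver_mul_apply_neg {(0 : G)} hb g
  have hmain := four_mul_sum_sumOver_mul_apply_neg C hb g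
  have e0 : g ≠ 0 := by simpa using hg 0 (by norm_num)
  have e1 : g - b ≠ 0 := sub_ne_zero.2 (by simpa using hg 1 (by norm_num))
  have e2 : g - 2 • b ≠ 0 := sub_ne_zero.2 (hg 2 (by norm_num))
  have e3 : g - 3 • b ≠ 0 := sub_ne_zero.2 (hg 3 (by norm_num))
  have hone (ψ : AddChar G ℂ) : ψ.sumOver {(0 : G)} = 1 := by
    simp [sumOver, Set.indicator_apply]
  simp only [hone, Set.indicator_apply, Set.mem_singleton_iff, e0, e1, e2, e3, if_false] at hconst
  have hex (ψ : AddChar G ℂ) : ∃ w : ℤ, ψ b = Complex.I → m ψ = ε + 2 * w := by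
    by_cases h : ψ b = Complex.I
    · obtain ⟨w, hw⟩ := hε ψ h
      exact ⟨w, fun _ => by omega⟩
    · exact ⟨0, fun h' => absurd h' h⟩
  choose w hw using hex
  set Z : ℂ := ∑ ψ : AddChar G ℂ, (if ψ b = Complex.I then (w ψ : ℂ) * ψ (-g) else 0) with hZ
  have hZint : IsIntegral ℤ Z := by
    refine IsIntegral.sum _ fun ψ _ => ?_
    split_ifs
    · exact (isIntegral_algebraMap (R := ℤ) (x := w ψ)).mul (ψ.isIntegral_apply _)
    · exact isIntegral_zero
  have hsplit : ∑ ψ : AddChar G ℂ, (if ψ b = Complex.I then ψ.sumOver C * ψ (-g) else 0) =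
      ε * ∑ ψ : AddChar G ℂ, (if ψ b = Complex.I then 1 * ψ (-g) else 0) + 2 * Z := by
    rw [hZ, Finset.mul_sum, Finset.mul_sum, ← Finset.sum_add_distrib]
    refine Finset.sum_congr rfl fun ψ _ => ?_
    split_ifs with h
    · rw [hm, hw ψ h]; push_cast; ring
    · simp
  have hconst0 : ∑ ψ : AddChar G ℂ, (if ψ b = Complex.I then 1 * ψ (-g) else 0) = 0 := by
    simpa using hconst
  rw [hsplit, hconst0, hcard] at hmain
  obtain ⟨x, y, hx, hx1, hy, hxy⟩ : ∃ x y : ℤ, (x = 0 ↔ (g ∈ C ↔ g - 2 • b ∈ C)) ∧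
      x ^ 2 ≤ 1 ∧ y ^ 2 ≤ 1 ∧ 2 * Z = N * (x + y * Complex.I) := by
    refine ⟨(if g ∈ C then 1 else 0) - (if g - 2 • b ∈ C then 1 else 0),
      (if g - 3 • b ∈ C then 1 else 0) - (if g - b ∈ C then 1 else 0), ?_, ?_, ?_, ?_⟩
    · split_ifs <;> simp_all
    · split_ifs <;> norm_num
    · split_ifs <;> norm_num
    · apply mul_left_cancel₀ (show (4 : ℂ) ≠ 0 by norm_num)
      simp only [Set.indicator_apply, Pi.one_apply] at hmain
      push_cast at hmain ⊢
      linear_combination hmain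
  -- The norm of `Z` is rational and an algebraic integer, hence an integer; as `N` is odd, `4 ∣ x²
  -- + y² ≤ 2`.
  have hnorm : 4 * (Z * (starRingEnd ℂ) Z) = ((N ^ 2 * (x ^ 2 + y ^ 2) : ℤ) : ℂ) := by
    have hc := congrArg (starRingEnd ℂ) hxy
    simp only [map_mul, map_add, map_natCast, map_intCast, Complex.conj_I, map_ofNat] at hc
    push_cast
    linear_combination (2 * (starRingEnd ℂ) Z) * hxy + N * (x + y * Complex.I) * hc -
      N ^ 2 * y ^ 2 * Complex.I_sq
  have hint : IsIntegral ℤ (Z * (starRingEnd ℂ) Z) :=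
    hZint.mul (hZint.map ((starRingEnd ℂ).toIntAlgHom))
  obtain ⟨t, ht⟩ := hint.exists_int_eq_of_rat
    (q := ((N ^ 2 * (x ^ 2 + y ^ 2) : ℤ) : ℚ) / 4) (by
      rw [Rat.cast_div, Rat.cast_intCast, ← hnorm]; norm_num)
  rw [ht] at hnorm
  have hnorm' : 4 * t = (N : ℤ) ^ 2 * (x ^ 2 + y ^ 2) := by exact_mod_cast hnorm
  have hcop : IsCoprime (4 : ℤ) ((N : ℤ) ^ 2) := by
    have : Nat.Coprime (2 ^ 2) (N ^ 2) := (Nat.coprime_two_left.2 hN).pow 2 2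
    exact_mod_cast Nat.isCoprime_iff_coprime.2 this
  have hdvd : (4 : ℤ) ∣ x ^ 2 + y ^ 2 := hcop.dvd_of_dvd_mul_left ⟨t, hnorm'.symm⟩
  rw [← hx]
  have : x ^ 2 = 0 := by
    have := sq_nonneg x
    have := sq_nonneg y
    omega
  exact pow_eq_zero_iff two_ne_zero |>.1 this

/-- If `C` is invariant under translation by the involution `a` except at `0` and `a`, then every
character with value `-1` at `a` has the same sum over `C`. -/
theorem sumOver_eq_of_apply_eq_neg_one {C : Set G} (h0 : (0 : G) ∉ C) {a : G} (ha : 2 • a = 0)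
    (ha0 : a ≠ 0) (hC : ∀ g, g ≠ 0 → g ≠ a → (g ∈ C ↔ g + a ∈ C)) {ψ : AddChar G ℂ}
    (hψ : ψ a = -1) : ψ.sumOver C = -C.indicator 1 a := by
  classical
  have haa : a + a = 0 := by rw [← two_nsmul, ha]
  -- Translation by `a` negates `ψ`; averaging with the original sum leaves only the terms at `0`
  -- and `a`.
  have h1 : ψ.sumOver C = -∑ c, C.indicator 1 (c + a) * ψ c := by
    rw [sumOver, ← Equiv.sum_comp (Equiv.addRight a), ← Finset.sum_neg_distrib]
    refine Finset.sum_congr rfl fun c _ => ?_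
    by_cases h : c + a ∈ C <;> simp [h, AddChar.map_add_eq_mul, hψ]
  have h2 : ψ.sumOver C = ∑ c, C.indicator 1 c * ψ c :=
    Finset.sum_congr rfl fun c _ => by simp [Set.indicator_apply]
  have h3 : 2 * ψ.sumOver C = ∑ c, (C.indicator 1 c - C.indicator 1 (c + a)) * ψ c := by
    simp_rw [sub_mul]
    rw [Finset.sum_sub_distrib, ← h2]
    linear_combination h1
  rw [Fintype.sum_eq_add 0 a ha0.symm] at h3
  · have hi0 : C.indicator (1 : G → ℂ) 0 = 0 := Set.indicator_of_notMem h0 _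
    rw [zero_add, haa, hi0, hψ, AddChar.map_zero_eq_one] at h3
    linear_combination h3 / 2
  · rintro c ⟨hc0, hca⟩
    simp [Set.indicator_apply, hC c hc0 hca]

end AddChar

/-! ### Parity of `|C|`, the group `ZMod 4 × H`, and the conclusion. -/

/-- A finite symmetric set containing neither `0` nor an involution other than `a` has odd size if
it contains `a`, and even size otherwise. -/
theorem Set.odd_ncard_iff_mem_of_neg_mem {G : Type*} [AddCommGroup G] [Finite G] {C : Set G}
    (hneg : ∀ g ∈ C, -g ∈ C) (h0 : (0 : G) ∉ C) {a : G} (ha : 2 • a = 0)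
    (huniq : ∀ g : G, 2 • g = 0 → g = 0 ∨ g = a) : Odd C.ncard ↔ a ∈ C := by
  classical
  have := Fintype.ofFinite G
  have haa : -a = a := neg_eq_of_add_eq_zero_left (by rw [← two_nsmul, ha])
  have hev : Even (C \ {a}).ncard := by
    rw [Set.ncard_eq_toFinset_card', ← ZMod.natCast_eq_zero_iff_even, Finset.card_eq_sum_ones,
      Nat.cast_sum]
    -- Negation has no fixed point on `C \ {a}`, so its elements cancel in pairs modulo 2.
    refine Finset.sum_involution (fun g _ => -g) (fun _ _ => by decide) ?_ ?_
      (fun _ _ => neg_neg _)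
    · intro g hg _ h
      rw [Set.mem_toFinset] at hg
      rcases huniq g (by rw [two_nsmul]; nth_rw 1 [← h]; exact neg_add_cancel g) with rfl | rfl
      exacts [h0 hg.1, hg.2 rfl]
    · intro g hg
      rw [Set.mem_toFinset] at hg ⊢
      refine ⟨hneg g hg.1, fun h => hg.2 ?_⟩
      rw [Set.mem_singleton_iff] at h ⊢
      rw [← neg_neg g, h, haa]
  by_cases h : a ∈ C
  · rw [← Set.ncard_sdiff_singleton_add_one h]
    exact iff_of_true hev.add_one h
  · rw [Set.sdiff_singleton_eq_self h] at hev
    exact iff_of_false (Nat.not_odd_iff_even.2 hev) h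

/-- In `ZMod 4 × H` with `H` of odd order, the elements killed by `2` are `0` and `(2, 0)`. -/
theorem ZMod.two_nsmul_four_prod_eq_zero {H : Type*} [AddCommGroup H] (hH : Odd (Nat.card H))
    {x : ZMod 4 × H} (hx : 2 • x = 0) : x = 0 ∨ x = (2, 0) := by
  obtain ⟨y, h⟩ := x
  rw [Prod.smul_mk, Prod.mk_eq_zero] at hx
  have hh : h = 0 := by
    rw [← AddMonoid.addOrderOf_eq_one_iff, ← Nat.dvd_one,
      ← (Nat.coprime_two_left.2 hH).gcd_eq_one]
    exact Nat.dvd_gcd (addOrderOf_dvd_of_nsmul_eq_zero hx.2) (addOrderOf_dvd_natCard h)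
  have hy : y = 0 ∨ y = 2 := by
    have := hx.1
    clear hx
    revert y
    decide
  subst hh
  rcases hy with rfl | rfl
  exacts [Or.inl rfl, Or.inr rfl]

/-- For a Cayley graph on `ZMod 4 × H` with perfect state transfer, the eigenvalues of the
characters are described by their value at the involution `a`. -/
theorem QuantumWalk.AdmitsPST.exists_int_eigenvalues {G H : Type*} [AddCommGroup G] [Fintype G]
    [DecidableEq G] [AddCommGroup H] (hH : Odd (Nat.card H)) (e : G ≃+ ZMod 4 × H)
    {C : Set G} [DecidableRel (SimpleGraph.addCayley C).Adj]
    (hCneg : ∀ g ∈ C, -g ∈ C) (hC0 : (0 : G) ∉ C) {a : G} (ha : 2 • a = 0) (ha0 : a ≠ 0)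
    (hpst : QuantumWalk.AdmitsPST (SimpleGraph.addCayley C)) :
    (∀ ψ : AddChar G ℂ, ∃ k : ℤ, ψ.sumOver C = k ∧ (Odd k ↔ a ∈ C)) ∧
      ∀ ψ : AddChar G ℂ, ψ.sumOver C = -C.indicator 1 a ↔ ψ a = -1 := by
  obtain ⟨u, v, huv, τ, l, h⟩ := hpst
  have hclass {g : G} (hg : 2 • g = 0) : e g = 0 ∨ e g = (2, 0) :=
    ZMod.two_nsmul_four_prod_eq_zero hH (by rw [← map_nsmul, hg, map_zero])
  have hea : e a = (2, 0) := (hclass ha).resolve_left (by simpa using ha0)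
  have huniq (g : G) (hg : 2 • g = 0) : g = 0 ∨ g = a := by
    refine (hclass hg).imp (by simp) fun h => e.injective (h.trans hea.symm)
  have huva : u - v = a :=
    (huniq _ (h.two_nsmul_sub_eq_zero hCneg hC0)).resolve_left (sub_ne_zero.2 huv)
  set b : G := e.symm (1, 0) with hb
  have hab : 2 • b = a := by
    rw [hb, ← map_nsmul, AddEquiv.symm_apply_eq, hea]
    simp
  have hb4 : 4 • b = 0 := by rw [show 4 = 2 * 2 from rfl, mul_nsmul, hab, ha]
  have hcard : Fintype.card G = 4 * Nat.card H := by
    rw [← Nat.card_eq_fintype_card, Nat.card_congr e.toEquiv, Nat.card_prod, Nat.card_zmod]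
  obtain ⟨m, k, hm, hk, hmul, hmk⟩ := h.exists_int_eigenvalues hCneg hC0 huv
  rw [huva] at hk
  have hodd {ψ : AddChar G ℂ} (hψ : ψ a = -1) : Odd (k ψ) :=
    ((hk ψ).resolve_left (by rw [hψ]; norm_num)).2
  have heven {ψ : AddChar G ℂ} (hψ : ψ a = 1) : Even (k ψ) :=
    ((hk ψ).resolve_right (by rw [hψ]; norm_num)).2
  obtain ⟨φ, hφ⟩ := AddChar.exists_apply_eq_neg_one ha ha0
  have hinv (g : G) (hg0 : g ≠ 0) (hga : g ≠ a) : g ∈ C ↔ g + a ∈ C := by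
    have hsub : g - a = g + a := by
      rw [sub_eq_iff_eq_add, add_assoc, ← two_nsmul, ha, add_zero]
    by_cases hg : ∀ j < 4, g ≠ j • b
    · rw [← hsub, ← hab]
      refine AddChar.mem_iff_sub_mem_of_even_sub C hb4 hH hcard m hm (m φ) (fun ψ hψ => ?_) hg
      have hψa : ψ a = -1 := by
        rw [← hab, AddChar.map_nsmul_eq_pow, hψ, Complex.I_sq]
      -- Both `k ψ` and `k φ` are odd, so proportionality gives `m ψ` and `m φ` the same parity.
      have h1 := congrArg Even (hmul ψ φ)
      have h2 := Int.not_even_iff_odd.2 (hodd hψa)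
      have h3 := Int.not_even_iff_odd.2 (hodd hφ)
      simp only [Int.even_mul, Int.even_sub, h2, h3, or_false, eq_iff_iff] at h1 ⊢
      tauto
    -- The multiples of `b` left over are `±b`, which translation by `a = 2b` swaps; here `C = -C`
    -- suffices.
    · have hneg : g + a = -g := by
        push Not at hg
        obtain ⟨j, hj, rfl⟩ := hg
        rw [eq_neg_iff_add_eq_zero, ← hab, ← add_nsmul, ← add_nsmul]
        interval_cases j
        · simp at hg0
        · exact hb4
        · exact absurd hab hga
        · rw [show 3 + 2 + 3 = 4 * 2 from rfl, mul_nsmul, hb4, nsmul_zero]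
      rw [hneg]
      exact ⟨hCneg g, fun h => by simpa using hCneg _ h⟩
  have hval {ψ : AddChar G ℂ} (hψ : ψ a = -1) : ψ.sumOver C = -C.indicator 1 a :=
    AddChar.sumOver_eq_of_apply_eq_neg_one hC0 ha ha0 hinv hψ
  refine ⟨fun ψ => ⟨m ψ, hm ψ, ?_⟩, fun ψ => ⟨fun hψ => ?_, hval⟩⟩
  · rcases ψ.apply_eq_one_or_neg_one ha with hψ | hψ
    · rw [← Set.odd_ncard_iff_mem_of_neg_mem hCneg hC0 ha huniq]
      -- Now `k ψ` is even and `k φ` odd, so `m ψ - |C|` is even.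
      have h1 := congrArg Even (hmul ψ φ)
      have h2 := heven hψ
      have h3 := Int.not_even_iff_odd.2 (hodd hφ)
      simp only [Int.even_mul, Int.even_sub, h2, h3, or_false, or_true, eq_iff_iff, iff_true,
        Int.even_coe_nat] at h1
      rw [← Int.not_even_iff_odd, h1, Nat.not_even_iff_odd]
    · have h1 := hval hψ
      rw [hm] at h1
      by_cases haC : a ∈ C
      · rw [Set.indicator_of_mem haC, Pi.one_apply] at h1
        have : m ψ = -1 := by exact_mod_cast h1
        simp [this, haC]
      · rw [Set.indicator_of_notMem haC, neg_zero] at h1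
        have : m ψ = 0 := by exact_mod_cast h1
        simp [this, haC]
  -- Equal eigenvalues have equal `k`, whose parity determines `ψ a`.
  · refine (ψ.apply_eq_one_or_neg_one ha).resolve_left fun hψ1 => ?_
    have h1 := hψ.trans (hval hφ).symm
    rw [hm, hm, Int.cast_inj] at h1
    have h2 := hodd hφ
    rw [← hmk ψ φ h1, ← Int.not_even_iff_odd] at h2
    exact h2 (heven hψ1)

/-- `SimpleGraph.addCayley C` is the Cayley graph `X(G, C)`: as `C` is inverse-closed and `0 ∉ C`,
vertices `g` and `h` are adjacent if and only if `h - g ∈ C`. -/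
theorem corollary7p4 {G H : Type*} [AddCommGroup G] [Fintype G] [DecidableEq G] [AddCommGroup H]
    (hH : Odd (Nat.card H)) (e : G ≃+ ZMod 4 × H)
    (C : Set G) [DecidableRel (SimpleGraph.addCayley C).Adj]
    (hCneg : ∀ g ∈ C, -g ∈ C) (hC0 : (0 : G) ∉ C)
    (a : G) (ha : addOrderOf a = 2)
    (hpst : QuantumWalk.AdmitsPST (SimpleGraph.addCayley C)) :
    (a ∈ C →
      (∀ μ : ℂ, QuantumWalk.IsEigenvalue (SimpleGraph.addCayley C) μ →
        ∃ k : ℤ, Odd k ∧ μ = (k : ℂ)) ∧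
      QuantumWalk.IsEigenvalue (SimpleGraph.addCayley C) (-1) ∧
      QuantumWalk.eigenvalueMultiplicity (SimpleGraph.addCayley C) (-1) = Fintype.card G / 2) ∧
    (a ∉ C →
      (∀ μ : ℂ, QuantumWalk.IsEigenvalue (SimpleGraph.addCayley C) μ →
        ∃ k : ℤ, Even k ∧ μ = (k : ℂ)) ∧
      QuantumWalk.IsEigenvalue (SimpleGraph.addCayley C) 0 ∧
      QuantumWalk.eigenvalueMultiplicity (SimpleGraph.addCayley C) 0 = Fintype.card G / 2) := by
  have ha2 : 2 • a = 0 := by rw [← ha]; exact addOrderOf_nsmul_eq_zero a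
  have ha0 : a ≠ 0 := by rintro rfl; simp at ha
  obtain ⟨hint, hiff⟩ := hpst.exists_int_eigenvalues hH e hCneg hC0 ha2 ha0
  obtain ⟨φ, hφ⟩ := AddChar.exists_apply_eq_neg_one ha2 ha0
  have hmult : Fintype.card {ψ : AddChar G ℂ // ψ.sumOver C = -C.indicator 1 a} =
      Fintype.card G / 2 := by
    simp only [hiff]
    rw [← AddChar.two_mul_card_apply_eq_neg_one ha2 ha0, Nat.mul_div_cancel_left _ two_pos]
  simp only [QuantumWalk.isEigenvalue_addCayley_iff hCneg hC0,
    QuantumWalk.eigenvalueMultiplicity_addCayley hCneg hC0]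
  refine ⟨fun haC => ?_, fun haC => ?_⟩
  · rw [Set.indicator_of_mem haC, Pi.one_apply] at hmult
    refine ⟨?_, ⟨φ, by rw [(hiff φ).2 hφ, Set.indicator_of_mem haC, Pi.one_apply]⟩, hmult⟩
    rintro μ ⟨ψ, rfl⟩
    obtain ⟨k, hk, hodd⟩ := hint ψ
    exact ⟨k, hodd.2 haC, hk⟩
  · rw [Set.indicator_of_notMem haC, neg_zero] at hmult
    refine ⟨?_, ⟨φ, by rw [(hiff φ).2 hφ, Set.indicator_of_notMem haC, neg_zero]⟩, hmult⟩
    rintro μ ⟨ψ, rfl⟩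
    obtain ⟨k, hk, hodd⟩ := hint ψ
    exact ⟨k, Int.not_odd_iff_even.1 fun h => haC (hodd.1 h), hk⟩
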